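/- Let $\mathcal Z$ be a measurable space, $n\ge 0$, $\alpha\in(0,1)$, and let $s:\mathcal Z\to\mathbb R_+$ be a measurable conformity score. A (fuzzy) prediction set is a jointly measurable map $D:\mathcal Z^n\times\mathcal Z\to[0,1]$, where $D(z^n,z)$ is the degree of exclusion of $z$ after observing $z^n$; an ordinary prediction set $C^{z^n}\subseteq\mathcal Z$ is the case $D(z^n,z)=\mathbb I\{z\notin C^{z^n}\}$. It is valid at level $\alpha$ if $\mathrm E^P[D(Z^n,Z_{n+1})]\le\alpha$ for every exchangeable law $P$ of $Z^{n+1}=(Z_1,\dots,Z_{n+1})$; for an ordinary set this says $P(Z_{n+1}\in C^{Z^n})\ge 1-\alpha$. Given a $\sigma$-finite measure $\mu$ on $\mathcal Z$, its expected $\mu$-size under the true law $P_*$ is $\mathrm E^{P_*^{Z^n}}\big[\int(1-D(Z^n,z))\,d\mu(z)\big]$, which for an ordinary set is $\mathrm E^{P_*^{Z^n}}[\mu(C^{Z^n})]$. For $z^n$ and $z$ let $L$ and $T$ be the numbers of entries of $(z_1,\dots,z_n,z)$ whose score is $<s(z)$ and $=s(z)$, respectively. Classical conformal prediction with score $s$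 at exact level $\alpha$ is $$D_s(z^n,z)=\min\{1,\max\{0,(\alpha(n+1)-L)/T\}\}:$$ it excludes $z$ if the conformal p-value $(L+T)/(n+1)$ is at most $\alpha$, includes $z$ if $L/(n+1)\ge\alpha$, and treats the boundary tie group so that the average degree of exclusion over the entries is $\alpha$. Its non-randomized version is $C_s^{z^n}=\{z:(L+T)/(n+1)>\alpha\}$. Then $D_s$ and $C_s$ are valid at level $\alpha$. Moreover, let $\mu$ be any $\sigma$-finite measure and $P_*^{Z^{n+1}}$ any i.i.d. law with $P_*^{Z_{n+1}}\ll\mu$ such that $$s=m\!\left(\frac{dP_*^{Z_{n+1}}}{d\mu}\right)\quad\mu\text{-a.e.}$$ for some strictly increasing $m:\mathbb R_+\to\mathbb R_+$. Then $D_s$ has the smallest expected $\mu$-size among all fuzzy, and hence among all ordinary, prediction sets that are valid at level $\alpha$. If in addition $\alpha(n+1)$ is an integer and $s(Z_1)$ has no atoms under $P_*$, then the ordinary conformal set $C_s$ itself has the smallest expected $\mu$-size among all of them. -/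

import Mathlib

open MeasureTheory
open scoped NNReal ENNReal

namespace Conformal

/-- A law on `Z^(n+1)` is exchangeable if it is invariant under all permutations of the entries. -/
def IsExchangeable {Z : Type*} [MeasurableSpace Z] {n : ℕ} (P : Measure (Fin (n + 1) → Z)) : Prop :=
  ∀ σ : Equiv.Perm (Fin (n + 1)), P.map (fun z i => z (σ i)) = P

/-- A (binary) prediction set: a function of the observations `z₁, …, zₙ`, whose value is the set
of points `z` that are included. -/
abbrev PredSet (n : ℕ) (Z : Type*) := (Fin n → Z) → Set Z

/-- A fuzzy prediction set: `D zn z ∈ [0, 1]` is the degree of exclusion of the point `z` after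
observing `zn` (`0` is full inclusion, `1` is full exclusion). -/
abbrev FuzzyPredSet (n : ℕ) (Z : Type*) := (Fin n → Z) → Z → unitInterval

/-- Level `α` validity for the exchangeable model: `P (Z_{n+1} ∈ C(Zⁿ)) ≥ 1 - α` for every
exchangeable law `P` on `Z^(n+1)`. -/
structure PredSet.IsValid {Z : Type*} [MeasurableSpace Z] {n : ℕ} (α : ℝ) (C : PredSet n Z) :
    Prop where
  measurableSet : MeasurableSet {x : (Fin n → Z) × Z | x.2 ∈ C x.1}
  coverage : ∀ P : Measure (Fin (n + 1) → Z), IsProbabilityMeasure P → IsExchangeable P →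
    1 - α ≤ P.real {z | z (Fin.last n) ∈ C (fun i => z i.castSucc)}

/-- Level `α` validity for the exchangeable model of a fuzzy prediction set: under every
exchangeable law on `Z^(n+1)` the expected degree of exclusion of `Z_{n+1}` is at most `α`. -/
structure FuzzyPredSet.IsValid {Z : Type*} [MeasurableSpace Z] {n : ℕ} (α : ℝ)
    (D : FuzzyPredSet n Z) : Prop where
  measurable : Measurable (fun x : (Fin n → Z) × Z => D x.1 x.2)
  coverage : ∀ P : Measure (Fin (n + 1) → Z), IsProbabilityMeasure P → IsExchangeable P →
    ∫ z, (D (fun i => z i.castSucc) (z (Fin.last n)) : ℝ) ∂P ≤ α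

/-- The expected `μ`-size `E[μ(C(Zⁿ))]`, where `Zⁿ` has law `ν`. -/
noncomputable def PredSet.expectedSize {Z : Type*} [MeasurableSpace Z] {n : ℕ} (μ : Measure Z)
    (ν : Measure (Fin n → Z)) (C : PredSet n Z) : ℝ≥0∞ :=
  ∫⁻ zn, μ (C zn) ∂ν

/-- The expected `μ`-size `E[∫ (1 - D(Zⁿ, z)) dμ(z)]` of a fuzzy prediction set, where `Zⁿ` has
law `ν`. It is the expected size of the randomized set that excludes `z` with probability
`D(Zⁿ, z)`. -/
noncomputable def FuzzyPredSet.expectedSize {Z : Type*} [MeasurableSpace Z] {n : ℕ} (μ : Measure Z)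
    (ν : Measure (Fin n → Z)) (D : FuzzyPredSet n Z) : ℝ≥0∞ :=
  ∫⁻ zn, ∫⁻ z, ENNReal.ofReal (1 - (D zn z : ℝ)) ∂μ ∂ν

/-- The number of entries of `(z₁, …, zₙ, z)` whose conformity score is smaller than that of `z`. -/
noncomputable def numBelow {Z : Type*} {n : ℕ} (s : Z → ℝ≥0) (zn : Fin n → Z) (z : Z) : ℕ :=
  (Finset.univ.filter fun i => s (zn i) < s z).card

/-- The number of entries of `(z₁, …, zₙ, z)` with the same conformity score as `z`
(`z` itself is one of them). -/
noncomputable def numTied {Z : Type*} {n : ℕ} (s : Z → ℝ≥0) (zn : Fin n → Z) (z : Z) : ℕ :=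
  (Finset.univ.filter fun i => s (zn i) = s z).card + 1

/-- The conformal p-value of `z`: the fraction of the entries of `(z₁, …, zₙ, z)` whose conformity
score is at most that of `z`. -/
noncomputable def pValue {Z : Type*} {n : ℕ} (s : Z → ℝ≥0) (zn : Fin n → Z) (z : Z) : ℝ :=
  (((Finset.univ.filter fun i => s (zn i) ≤ s z).card : ℝ) + 1) / ((n : ℝ) + 1)

/-- Classical conformal prediction without randomization: `z` is included iff its p-value
exceeds `α`. -/
def conformalSet {Z : Type*} {n : ℕ} (α : ℝ) (s : Z → ℝ≥0) : PredSet n Z :=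
  fun zn => {z | α < pValue s zn z}

/-- Classical conformal prediction with exact level `α`. With `L = numBelow` and `T = numTied`,
the degree of exclusion of `z` is `(α (n + 1) - L) / T` clamped to `[0, 1]`. So `z` is fully
excluded if `(L + T) / (n + 1) ≤ α` (that is, if its p-value is at most `α`), fully included if
`L / (n + 1) ≥ α`, and the one group of tied scores that straddles the level is excluded to the
degree that makes the average degree of exclusion over the entries of `(z₁, …, zₙ, z)` equal to
`α`. It is the probability that the smoothed p-value `(L + U T) / (n + 1)`, with `U` uniform on
`[0, 1]`, is at most `α`. -/
noncomputable def conformalFuzzy {Z : Type*} {n : ℕ} (α : ℝ) (s : Z → ℝ≥0) : FuzzyPredSet n Z :=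
  fun zn z => Set.projIcc (0 : ℝ) 1 zero_le_one
    ((α * ((n : ℝ) + 1) - (numBelow s zn z : ℝ)) / (numTied s zn z : ℝ))

end Conformal

/-!
Applied to the law of a uniformly random rearrangement of a fixed vector `z`, validity says that
the degrees of exclusion of the last entry, averaged over the rearrangements of `z`, are at most
`α`, and the exact-level conformal set attains `min α 1` for every `z`. If `P` has density `f` with
respect to `μ`, then symmetrizing the expected `μ`-size over rearrangements turns it into the
`μ^(n+1)`-integral of a weighted sum of degrees of inclusion over the rearrangements of `z`, where
the weight of putting the entry `z j` last is the leave-one-out product `∏_{i ≠ j} f (z i)`. This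
weight is largest where `f (z j)` is smallest, so by the Neyman–Pearson argument the best use of
the exclusion budget is to exclude the entries with the smallest density first. If `f` is a
monotone function of the score, this is exactly what the exact-level conformal set does, and hence
it is optimal for every `z`, with no knowledge of `f`. When `α (n + 1)` is an integer and there are
no ties, it never excludes to a fractional degree and agrees with the non-randomized set.
-/

namespace ConformalPrediction

open Conformal
open scoped Finset

section Exclusion

variable {ι R : Type*} [Fintype ι] [LinearOrder R]

theorem card_filter_le_eq_add (a : ι → R) (b : R) :
    #{i | a i ≤ b} = #{i | a i < b} + #{i | a i = b} := by
  classical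
  rw [← Finset.card_union_of_disjoint (Finset.disjoint_filter.2 fun _ _ h => h.ne),
    ← Finset.filter_or]
  simp only [le_iff_lt_or_eq]

theorem card_filter_eq_castSucc_add {n : ℕ} (p : Fin (n + 1) → Prop) [DecidablePred p] :
    #{i | p i} = #{i : Fin n | p i.castSucc} + if p (Fin.last n) then 1 else 0 := by
  simp only [Finset.card_filter, Fin.sum_univ_castSucc]

theorem card_filter_comp_equiv {κ : Type*} [Fintype κ] (σ : κ ≃ ι) (p : ι → Prop)
    [DecidablePred p] : #{i | p (σ i)} = #{i | p i} := by
  simp only [Finset.card_filter]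
  exact Equiv.sum_comp σ fun i => if p i then 1 else 0

/-- The degree to which the entry `j` of a finite family of scores `a` is excluded when a total
degree of exclusion `β` is spent on the entries in increasing order of score, in equal parts
within a group of ties. -/
noncomputable def exclusion (β : ℝ) (a : ι → R) (j : ι) : unitInterval :=
  Set.projIcc 0 1 zero_le_one ((β - #{i | a i < a j}) / #{i | a i = a j})

theorem exclusion_comp_equiv {κ : Type*} [Fintype κ] (β : ℝ) (a : ι → R) (σ : κ ≃ ι) (j : κ) :
    exclusion β (a ∘ σ) j = exclusion β a (σ j) := by
  simp only [exclusion, Function.comp_apply, card_filter_comp_equiv σ fun i => a i < a (σ j),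
    card_filter_comp_equiv σ fun i => a i = a (σ j)]

theorem card_filter_eq_pos (a : ι → R) (j : ι) : (0 : ℝ) < #{i | a i = a j} :=
  Nat.cast_pos.2 (Finset.card_pos.2 ⟨j, by simp⟩)

theorem exclusion_eq_one {β : ℝ} {a : ι → R} {j : ι} (h : (#{i | a i ≤ a j} : ℝ) ≤ β) :
    exclusion β a j = 1 := by
  rw [card_filter_le_eq_add, Nat.cast_add] at h
  exact Set.projIcc_of_right_le _
    ((one_le_div (card_filter_eq_pos a j)).2 (le_sub_iff_add_le'.2 h))

theorem exclusion_eq_zero {β : ℝ} {a : ι → R} {j : ι} (h : β ≤ #{i | a i < a j}) :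
    exclusion β a j = 0 :=
  Set.projIcc_of_le_left _ (div_nonpos_of_nonpos_of_nonneg (sub_nonpos.2 h) (Nat.cast_nonneg _))

theorem card_filter_eq_mul_exclusion {β : ℝ} {a : ι → R} {j : ι} (h : (#{i | a i < a j} : ℝ) ≤ β) :
    #{i | a i = a j} * (exclusion β a j : ℝ) = min β #{i | a i ≤ a j} - #{i | a i < a j} := by
  have hT := card_filter_eq_pos a j
  rw [exclusion, Set.coe_projIcc, max_eq_right (le_min zero_le_one
    (div_nonneg (sub_nonneg.2 h) hT.le)), mul_min_of_nonneg _ _ hT.le, mul_one,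
    mul_div_cancel₀ _ hT.ne', card_filter_le_eq_add, Nat.cast_add, ← min_sub_sub_right,
    add_sub_cancel_left, min_comm]

/-- The entry `t` belongs to the group of ties of the scores `a` at which a total degree of
exclusion `β`, spent in increasing order of score, runs out. -/
structure IsBoundary (β : ℝ) (a : ι → R) (t : ι) : Prop where
  card_lt_le : (#{i | a i < a t} : ℝ) ≤ β
  lt_card_lt : ∀ j, a t < a j → β < #{i | a i < a j}

theorem exists_isBoundary [Nonempty ι] {β : ℝ} (hβ : 0 ≤ β) (a : ι → R) :
    ∃ t, IsBoundary β a t := by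
  obtain ⟨b, hb⟩ := Finite.exists_min a
  have hbelow : #{i | a i < a b} = 0 := by simp [hb]
  obtain ⟨t, ht, hmax⟩ := Finset.exists_max_image {j | (#{i | a i < a j} : ℝ) ≤ β} a
    ⟨b, by simp [hbelow, hβ]⟩
  simp only [Finset.mem_filter_univ] at ht hmax
  exact ⟨t, ht, fun j hj => not_le.1 fun h => (hmax j h).not_gt hj⟩

namespace IsBoundary

variable {β : ℝ} {a : ι → R} {t : ι}

theorem exclusion_eq_one (ht : IsBoundary β a t) {j : ι} (hj : a j < a t) :
    exclusion β a j = 1 := by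
  refine ConformalPrediction.exclusion_eq_one (le_trans ?_ ht.card_lt_le)
  gcongr

theorem exclusion_eq_zero (ht : IsBoundary β a t) {j : ι} (hj : a t < a j) :
    exclusion β a j = 0 :=
  ConformalPrediction.exclusion_eq_zero (ht.lt_card_lt j hj).le

theorem min_card_filter_le (ht : IsBoundary β a t) :
    min β #{i | a i ≤ a t} = min β (Fintype.card ι) := by
  by_cases htop : ∀ i, a i ≤ a t
  · simp [htop]
  · obtain ⟨u, hu, hmin⟩ := Finset.exists_min_image {i | a t < a i} a
      (by simpa [Finset.filter_nonempty_iff] using htop)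
    simp only [Finset.mem_filter_univ] at hu hmin
    have hcard : #{i | a i < a u} = #{i | a i ≤ a t} := by
      refine congrArg _ (Finset.filter_congr fun i _ => ?_)
      exact ⟨fun h => not_lt.1 fun hi => (hmin i hi).not_gt h, fun h => h.trans_lt hu⟩
    have hβ : β < #{i | a i ≤ a t} := hcard ▸ ht.lt_card_lt u hu
    have hle : (#{i | a i ≤ a t} : ℝ) ≤ Fintype.card ι := mod_cast Finset.card_le_univ _
    rw [min_eq_left hβ.le, min_eq_left (hβ.le.trans hle)]

theorem sum_exclusion (ht : IsBoundary β a t) :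
    ∑ j, (exclusion β a j : ℝ) = min β (Fintype.card ι) := by
  have hsplit (j : ι) : (exclusion β a j : ℝ) =
      (if a j < a t then 1 else 0) + if a j = a t then (exclusion β a t : ℝ) else 0 := by
    rcases lt_trichotomy (a j) (a t) with h | h | h
    · simp [h, h.ne, ht.exclusion_eq_one h]
    · simp [h, exclusion]
    · simp [h.ne', h.not_gt, ht.exclusion_eq_zero h]
  rw [Finset.sum_congr rfl fun j _ => hsplit j, Finset.sum_add_distrib, Finset.sum_boole,
    ← Finset.sum_filter, Finset.sum_const, nsmul_eq_mul,
    card_filter_eq_mul_exclusion ht.card_lt_le, add_sub_cancel, ht.min_card_filter_le]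

end IsBoundary

end Exclusion

section NeymanPearson

variable {κ : Type*} [Fintype κ]

theorem sum_one_sub_mul_le_of_threshold {d e w : κ → ℝ} {c : ℝ} (hc : 0 ≤ c)
    (hd₀ : ∀ i, 0 ≤ d i) (hd₁ : ∀ i, d i ≤ 1) (hgt : ∀ i, c < w i → e i = 1)
    (hlt : ∀ i, w i < c → e i = 0) (hsum : ∑ i, d i ≤ ∑ i, e i) :
    ∑ i, (1 - e i) * w i ≤ ∑ i, (1 - d i) * w i := by
  have hterm (i : κ) : 0 ≤ (e i - d i) * (w i - c) := by
    rcases lt_trichotomy (w i) c with h | h | h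
    · rw [hlt i h]
      exact mul_nonneg_of_nonpos_of_nonpos (by linarith [hd₀ i]) (sub_nonpos.2 h.le)
    · rw [h, sub_self, mul_zero]
    · rw [hgt i h]
      exact mul_nonneg (sub_nonneg.2 (hd₁ i)) (sub_nonneg.2 h.le)
  have hexpand : ∑ i, (e i - d i) * (w i - c) =
      ∑ i, (1 - d i) * w i - ∑ i, (1 - e i) * w i - (∑ i, e i - ∑ i, d i) * c := by
    simp only [← Finset.sum_sub_distrib, Finset.sum_mul]
    exact Finset.sum_congr rfl fun i _ => by ring
  linarith [Finset.sum_nonneg fun i (_ : i ∈ Finset.univ) => hterm i,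
    mul_nonneg (sub_nonneg.2 hsum) hc]

theorem sum_ofReal_one_sub_mul (d : κ → unitInterval) (w : κ → ℝ≥0) :
    ∑ i, ENNReal.ofReal (1 - d i) * w i = ENNReal.ofReal (∑ i, (1 - (d i : ℝ)) * w i) := by
  have hd (i : κ) : 0 ≤ 1 - (d i : ℝ) := sub_nonneg.2 (d i).2.2
  rw [ENNReal.ofReal_sum_of_nonneg fun i _ => mul_nonneg (hd i) (w i).coe_nonneg]
  simp only [ENNReal.ofReal_mul (hd _), ENNReal.ofReal_coe_nnreal]

theorem sum_ofReal_one_sub_mul_le_of_threshold {d e : κ → unitInterval} {w : κ → ℝ≥0∞} {c : ℝ≥0∞}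
    (hw : ∀ i, w i ≠ ∞) (hc : c ≠ ∞) (hgt : ∀ i, c < w i → e i = 1) (hlt : ∀ i, w i < c → e i = 0)
    (hsum : ∑ i, (d i : ℝ) ≤ ∑ i, (e i : ℝ)) :
    ∑ i, ENNReal.ofReal (1 - e i) * w i ≤ ∑ i, ENNReal.ofReal (1 - d i) * w i := by
  lift w to κ → ℝ≥0 using hw
  lift c to ℝ≥0 using hc
  rw [sum_ofReal_one_sub_mul, sum_ofReal_one_sub_mul]
  refine ENNReal.ofReal_le_ofReal (sum_one_sub_mul_le_of_threshold c.2 (fun i => (d i).2.1)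
    (fun i => (d i).2.2) (fun i hi => ?_) (fun i hi => ?_) hsum)
  · simp [hgt i (ENNReal.coe_lt_coe.2 hi)]
  · simp [hlt i (ENNReal.coe_lt_coe.2 hi)]

end NeymanPearson

section LeaveOneOut

variable {M : Type*} [CommMonoid M]

theorem prod_erase_le_prod_erase {ι : Type*} [DecidableEq ι] [Preorder M]
    [IsOrderedMonoid M] {S : Finset ι} {j t : ι} (hj : j ∈ S) (ht : t ∈ S) {f : ι → M}
    (h : f j ≤ f t) : ∏ i ∈ S.erase t, f i ≤ ∏ i ∈ S.erase j, f i := by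
  rcases eq_or_ne j t with rfl | hjt
  · exact le_rfl
  · rw [← Finset.mul_prod_erase _ f (Finset.mem_erase.2 ⟨hjt, hj⟩),
      ← Finset.mul_prod_erase _ f (Finset.mem_erase.2 ⟨hjt.symm, ht⟩), Finset.erase_right_comm]
    exact mul_le_mul_left h _

theorem prod_perm_castSucc {n : ℕ} (f : Fin (n + 1) → M)
    (σ : Equiv.Perm (Fin (n + 1))) :
    ∏ i : Fin n, f (σ i.castSucc) = ∏ i ∈ Finset.univ.erase (σ (Fin.last n)), f i := by
  have himage : Finset.univ.erase (σ (Fin.last n)) =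
      ((Finset.univ.erase (Fin.last n)).map σ.toEmbedding) := by
    simp [Finset.map_erase]
  rw [himage, Finset.prod_map, ← Finset.compl_singleton, ← Fin.image_castSucc,
    Finset.prod_image (Fin.castSucc_injective n).injOn]
  rfl

end LeaveOneOut

section ProductMeasures

variable {ι : Type*} {X : ι → Type*} [∀ i, MeasurableSpace (X i)]
  (μ : ∀ i, Measure (X i)) [∀ i, SigmaFinite (μ i)] {f : ∀ i, X i → ℝ≥0∞}

theorem lmarginal_prod_pi [DecidableEq ι] (hf : ∀ i, Measurable (f i)) (s : Finset ι)
    (x : ∀ i, X i) :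
    (∫⋯∫⁻_s, (fun x => ∏ i ∈ s, f i (x i)) ∂μ) x = ∏ i ∈ s, ∫⁻ y, f i y ∂μ i := by
  have hprod (s : Finset ι) : Measurable fun x : ∀ i, X i => ∏ i ∈ s, f i (x i) :=
    Finset.measurable_prod _ fun i _ => (hf i).comp (measurable_pi_apply i)
  induction s using Finset.induction_on generalizing x with
  | empty => simp
  | insert i s hi ih =>
    have hsplit (x : ∀ i, X i) : ∫⁻ y, ∏ j ∈ insert i s, f j (Function.update x i y j) ∂μ i =
        (∫⁻ y, f i y ∂μ i) * ∏ j ∈ s, f j (x j) := by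
      rw [← lintegral_mul_const _ (hf i)]
      refine lintegral_congr fun y => ?_
      rw [Finset.prod_insert hi, Function.update_self]
      refine congrArg _ (Finset.prod_congr rfl fun j hj => ?_)
      rw [Function.update_of_ne (ne_of_mem_of_not_mem hj hi)]
    rw [lmarginal_insert' _ (hprod _) hi, Finset.prod_insert hi, ← ih x]
    simp only [hsplit]
    exact lintegral_const_mul _ ((hprod s).comp measurable_updateFinset)

variable [Fintype ι]

theorem lintegral_prod_pi (hf : ∀ i, Measurable (f i)) :
    ∫⁻ x, ∏ i, f i (x i) ∂Measure.pi μ = ∏ i, ∫⁻ y, f i y ∂μ i := by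
  classical
  rcases isEmpty_or_nonempty (∀ i, X i) with hX | ⟨⟨x⟩⟩
  · obtain ⟨i, _⟩ := isEmpty_pi.1 hX
    rw [lintegral_of_isEmpty, Finset.prod_eq_zero (Finset.mem_univ i) (lintegral_of_isEmpty _ _)]
  · rw [← lmarginal_prod_pi μ hf Finset.univ x, lmarginal_univ]

theorem pi_withDensity (hf : ∀ i, Measurable (f i)) [∀ i, SigmaFinite ((μ i).withDensity (f i))] :
    (Measure.pi fun i => (μ i).withDensity (f i)) =
      (Measure.pi μ).withDensity fun x => ∏ i, f i (x i) := by
  classical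
  refine Measure.pi_eq fun t ht => ?_
  have hind (x : ∀ i, X i) : (Set.univ.pi t).indicator (fun x => ∏ i, f i (x i)) x =
      ∏ i, (t i).indicator (f i) (x i) := by
    simp only [Set.indicator_apply, Finset.prod_ite_zero, Set.mem_univ_pi, Finset.mem_univ,
      true_imp_iff]
  rw [withDensity_apply _ (.univ_pi ht), ← lintegral_indicator (.univ_pi ht)]
  simp only [hind, lintegral_prod_pi μ fun i => (hf i).indicator (ht i),
    lintegral_indicator (ht _), withDensity_apply _ (ht _)]

end ProductMeasures

section Measurability

variable {Ω : Type*} [MeasurableSpace Ω]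

theorem measurable_card_filter {ι : Type*} [Fintype ι] (p : ι → Ω → Prop)
    [∀ x, DecidablePred fun i => p i x] (hp : ∀ i, MeasurableSet {x | p i x}) :
    Measurable fun x => #{i | p i x} := by
  simp only [Finset.card_filter]
  exact Finset.measurable_sum _ fun i _ => Measurable.ite (hp i) measurable_const measurable_const

theorem ae_lt_top_of_sigmaFinite_withDensity {μ : Measure Ω} [SigmaFinite μ] {f : Ω → ℝ≥0∞}
    (hf : Measurable f) [SigmaFinite (μ.withDensity f)] : ∀ᵐ ω ∂μ, f ω < ∞ := by
  filter_upwards [Measure.rnDeriv_withDensity μ hf, Measure.rnDeriv_lt_top (μ.withDensity f) μ]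
    with ω hω hlt
  rwa [← hω]

theorem lintegral_lintegral_pi_eq_lintegral_pi_succ {n : ℕ} (μ : Measure Ω) [SigmaFinite μ]
    {h : (Fin n → Ω) × Ω → ℝ≥0∞} (hh : Measurable h) :
    ∫⁻ zn, ∫⁻ z, h (zn, z) ∂μ ∂(Measure.pi fun _ : Fin n => μ) =
      ∫⁻ z, h (fun i => z i.castSucc, z (Fin.last n)) ∂(Measure.pi fun _ : Fin (n + 1) => μ) := by
  have hmp := (measurePreserving_piFinSuccAbove (fun _ : Fin (n + 1) => μ) (Fin.last n)).symm
  rw [← hmp.lintegral_comp_emb (MeasurableEquiv.measurableEmbedding _)]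
  simp only [MeasurableEquiv.piFinSuccAbove_symm_apply, Fin.insertNthEquiv_apply,
    Fin.insertNth_last', Fin.snoc_castSucc, Fin.snoc_last]
  exact (lintegral_prod_symm _ (hh.comp measurable_swap).aemeasurable).symm

end Measurability

section PredictionSets

variable {Z : Type*} {n : ℕ}

/-- The degree to which the fuzzy prediction set `D` excludes the last entry of `z` after observing
the other entries. -/
def lastDegree (D : FuzzyPredSet n Z) (z : Fin (n + 1) → Z) : unitInterval :=
  D (fun i => z i.castSucc) (z (Fin.last n))

/-- The fuzzy prediction set given by the indicator of exclusion from a prediction set. -/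
noncomputable def toFuzzy (C : PredSet n Z) : FuzzyPredSet n Z :=
  open Classical in fun zn z => if z ∈ C zn then 0 else 1

theorem lastDegree_conformalFuzzy (α : ℝ) (s : Z → ℝ≥0) (z : Fin (n + 1) → Z) :
    lastDegree (conformalFuzzy α s) z = exclusion (α * (n + 1)) (s ∘ z) (Fin.last n) := by
  rw [lastDegree, conformalFuzzy, exclusion, numBelow, numTied,
    card_filter_eq_castSucc_add fun i => (s ∘ z) i < (s ∘ z) (Fin.last n),
    card_filter_eq_castSucc_add fun i => (s ∘ z) i = (s ∘ z) (Fin.last n)]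
  simp

theorem lastDegree_conformalFuzzy_comp_perm (α : ℝ) (s : Z → ℝ≥0) (z : Fin (n + 1) → Z)
    (σ : Equiv.Perm (Fin (n + 1))) :
    lastDegree (conformalFuzzy α s) (z ∘ σ) =
      exclusion (α * (n + 1)) (s ∘ z) (σ (Fin.last n)) := by
  rw [lastDegree_conformalFuzzy, ← Function.comp_assoc, exclusion_comp_equiv]

theorem mem_conformalSet_iff {α : ℝ} {s : Z → ℝ≥0} {zn : Fin n → Z} {z : Z} :
    z ∈ conformalSet α s zn ↔ α * (n + 1) < numBelow s zn z + numTied s zn z := by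
  rw [conformalSet, Set.mem_ofPred_eq, pValue, lt_div_iff₀ (by positivity),
    card_filter_le_eq_add fun i => s (zn i)]
  simp [numBelow, numTied, add_assoc]

theorem conformalFuzzy_eq_one {α : ℝ} {s : Z → ℝ≥0} {zn : Fin n → Z} {z : Z}
    (h : z ∉ conformalSet α s zn) : conformalFuzzy α s zn z = 1 := by
  have hT : (0 : ℝ) < numTied s zn z := by simp [numTied, Nat.cast_add_one_pos]
  rw [mem_conformalSet_iff, not_lt] at h
  exact Set.projIcc_of_right_le _ ((one_le_div hT).2 (le_sub_iff_add_le'.2 h))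

theorem toFuzzy_conformalSet_le (α : ℝ) (s : Z → ℝ≥0) (zn : Fin n → Z) (z : Z) :
    toFuzzy (conformalSet α s) zn z ≤ conformalFuzzy α s zn z := by
  by_cases h : z ∈ conformalSet α s zn
  · simp [toFuzzy, h]
  · simp [toFuzzy, h, conformalFuzzy_eq_one h]

theorem toFuzzy_conformalSet_of_no_ties {α : ℝ} {s : Z → ℝ≥0} {k : ℕ} (hk : α * (n + 1) = k)
    {zn : Fin n → Z} {z : Z} (h : ∀ i, s (zn i) ≠ s z) :
    toFuzzy (conformalSet α s) zn z = conformalFuzzy α s zn z := by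
  by_cases hz : z ∈ conformalSet α s zn
  · have hT : numTied s zn z = 1 := by simp [numTied, h]
    have hkL : k ≤ numBelow s zn z := by
      rw [mem_conformalSet_iff, hk, hT] at hz
      exact Nat.lt_succ_iff.1 (mod_cast hz)
    rw [toFuzzy, if_pos hz, conformalFuzzy, hT, hk, Nat.cast_one, div_one,
      Set.projIcc_of_le_left _ (sub_nonpos.2 (Nat.cast_le.2 hkL))]
    rfl
  · simp [toFuzzy, hz, conformalFuzzy_eq_one hz]

end PredictionSets

section MeasurablePredictionSets

variable {Z : Type*} [MeasurableSpace Z] {n : ℕ}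

theorem measurable_numBelow {s : Z → ℝ≥0} (hs : Measurable s) :
    Measurable fun x : (Fin n → Z) × Z => numBelow s x.1 x.2 :=
  measurable_card_filter _ fun _ => measurableSet_lt (by fun_prop) (by fun_prop)

theorem measurable_numTied {s : Z → ℝ≥0} (hs : Measurable s) :
    Measurable fun x : (Fin n → Z) × Z => numTied s x.1 x.2 :=
  (measurable_card_filter _ fun _ => measurableSet_eq_fun (by fun_prop) (by fun_prop)).add_const 1

theorem measurable_conformalFuzzy (α : ℝ) {s : Z → ℝ≥0} (hs : Measurable s) :
    Measurable fun x : (Fin n → Z) × Z => conformalFuzzy α s x.1 x.2 :=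
  continuous_projIcc.measurable.comp
    (((measurable_from_nat.comp (measurable_numBelow hs)).const_sub _).div
      (measurable_from_nat.comp (measurable_numTied hs)))

theorem measurableSet_conformalSet (α : ℝ) {s : Z → ℝ≥0} (hs : Measurable s) :
    MeasurableSet {x : (Fin n → Z) × Z | x.2 ∈ conformalSet α s x.1} := by
  simp only [mem_conformalSet_iff]
  exact measurableSet_lt measurable_const
    ((measurable_from_nat.comp (measurable_numBelow hs)).add
      (measurable_from_nat.comp (measurable_numTied hs)))

theorem measurable_toFuzzy {C : PredSet n Z}
    (hC : MeasurableSet {x : (Fin n → Z) × Z | x.2 ∈ C x.1}) :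
    Measurable fun x : (Fin n → Z) × Z => toFuzzy C x.1 x.2 :=
  open Classical in Measurable.ite hC measurable_const measurable_const

theorem measurable_lastDegree {D : FuzzyPredSet n Z}
    (hD : Measurable fun x : (Fin n → Z) × Z => D x.1 x.2) : Measurable (lastDegree D) :=
  hD.comp (f := fun z : Fin (n + 1) → Z => (fun i : Fin n => z i.castSucc, z (Fin.last n)))
    (by fun_prop)

theorem integrable_lastDegree {D : FuzzyPredSet n Z}
    (hD : Measurable fun x : (Fin n → Z) × Z => D x.1 x.2) (P : Measure (Fin (n + 1) → Z))
    [IsFiniteMeasure P] : Integrable (fun z => (lastDegree D z : ℝ)) P := by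
  refine Integrable.of_bound (measurable_lastDegree hD).subtype_val.aestronglyMeasurable 1
    (.of_forall fun z => ?_)
  rw [Real.norm_of_nonneg (unitInterval.nonneg _)]
  exact unitInterval.le_one _

end MeasurablePredictionSets

section Exchangeability

variable {Z : Type*} [MeasurableSpace Z] {n : ℕ}

theorem measurePreserving_comp_perm {P : Measure (Fin (n + 1) → Z)} (hP : IsExchangeable P)
    (σ : Equiv.Perm (Fin (n + 1))) : MeasurePreserving (fun z => z ∘ σ) P P :=
  ⟨measurable_pi_lambda _ fun _ => measurable_pi_apply _, hP σ⟩

theorem isExchangeable_pi (μ : Measure Z) [SigmaFinite μ] :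
    IsExchangeable (Measure.pi fun _ : Fin (n + 1) => μ) := by
  intro σ
  convert (measurePreserving_piCongrLeft (fun _ => μ) σ.symm).map_eq using 2
  ext z i
  simp [MeasurableEquiv.coe_piCongrLeft, Equiv.piCongrLeft_apply]

/-- The law of a uniformly random rearrangement of the vector `z`. Validity under this law bounds
the average degree of exclusion over the rearrangements of `z`. -/
noncomputable def orbitLaw (z : Fin (n + 1) → Z) : Measure (Fin (n + 1) → Z) :=
  (Fintype.card (Equiv.Perm (Fin (n + 1))) : ℝ≥0∞)⁻¹ •
    ∑ σ : Equiv.Perm (Fin (n + 1)), Measure.dirac (z ∘ σ)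

instance isProbabilityMeasure_orbitLaw (z : Fin (n + 1) → Z) :
    IsProbabilityMeasure (orbitLaw z) where
  measure_univ := by
    simp only [orbitLaw, Measure.smul_apply, Measure.finsetSum_apply, measure_univ,
      Finset.sum_const, Finset.card_univ, nsmul_eq_mul, mul_one, smul_eq_mul]
    exact ENNReal.inv_mul_cancel (by simp) (by simp)

theorem isExchangeable_orbitLaw (z : Fin (n + 1) → Z) : IsExchangeable (orbitLaw z) := by
  intro τ
  have hτ : Measurable fun (y : Fin (n + 1) → Z) i => y (τ i) := by fun_prop
  rw [orbitLaw, Measure.map_smul, ← Measure.mapₗ_apply_of_measurable hτ, map_sum]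
  simp only [Measure.mapₗ_apply_of_measurable hτ, Measure.map_dirac' hτ]
  exact congrArg _ (Equiv.sum_comp (Equiv.mulRight τ) fun σ => Measure.dirac (z ∘ σ))

theorem integral_orbitLaw (z : Fin (n + 1) → Z) {g : (Fin (n + 1) → Z) → ℝ} (hg : Measurable g) :
    ∫ y, g y ∂orbitLaw z =
      (Fintype.card (Equiv.Perm (Fin (n + 1))) : ℝ)⁻¹ *
        ∑ σ : Equiv.Perm (Fin (n + 1)), g (z ∘ σ) := by
  rw [orbitLaw, integral_smul_measure, integral_finsetSum_measure fun σ _ =>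
    integrable_dirac' hg.stronglyMeasurable (by finiteness)]
  simp only [integral_dirac' _ _ hg.stronglyMeasurable, ENNReal.toReal_inv,
    ENNReal.toReal_natCast, smul_eq_mul]

end Exchangeability

section Validity

variable {Z : Type*} [MeasurableSpace Z] {n : ℕ} {α : ℝ}

theorem integral_lastDegree_conformalFuzzy (hα : 0 ≤ α) {s : Z → ℝ≥0} (hs : Measurable s)
    {P : Measure (Fin (n + 1) → Z)} [IsProbabilityMeasure P] (hP : IsExchangeable P) :
    ∫ z, (lastDegree (conformalFuzzy α s) z : ℝ) ∂P = min α 1 := by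
  set D : FuzzyPredSet n Z := conformalFuzzy α s
  have hD := integrable_lastDegree (measurable_conformalFuzzy α hs) P
  let toLast (j : Fin (n + 1)) := Equiv.swap (Fin.last n) j
  have hint (j : Fin (n + 1)) : Integrable (fun z => (lastDegree D (z ∘ toLast j) : ℝ)) P :=
    (measurePreserving_comp_perm hP (toLast j)).integrable_comp_of_integrable hD
  have hinv (j : Fin (n + 1)) :
      ∫ z, (lastDegree D (z ∘ toLast j) : ℝ) ∂P = ∫ z, (lastDegree D z : ℝ) ∂P := by
    have hmp := measurePreserving_comp_perm hP (toLast j)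
    rw [← integral_map (f := fun z => (lastDegree D z : ℝ)) hmp.measurable.aemeasurable
      (by rw [hmp.map_eq]; exact hD.aestronglyMeasurable), hmp.map_eq]
  have hsum (z : Fin (n + 1) → Z) :
      ∑ j, (lastDegree D (z ∘ toLast j) : ℝ) = (n + 1) * min α 1 := by
    obtain ⟨t, ht⟩ := exists_isBoundary (by positivity : 0 ≤ α * ((n : ℝ) + 1)) (s ∘ z)
    simp only [D, toLast, lastDegree_conformalFuzzy_comp_perm, Equiv.swap_apply_left,
      ht.sum_exclusion, Fintype.card_fin, Nat.cast_add_one]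
    rw [mul_min_of_nonneg _ _ (by positivity), mul_one, mul_comm]
  have hsymm : ((n : ℝ) + 1) * ∫ z, (lastDegree D z : ℝ) ∂P = (n + 1) * min α 1 := by
    calc ((n : ℝ) + 1) * ∫ z, (lastDegree D z : ℝ) ∂P
        = ∑ j, ∫ z, (lastDegree D (z ∘ toLast j) : ℝ) ∂P := by simp [hinv]
      _ = ∫ z, ∑ j, (lastDegree D (z ∘ toLast j) : ℝ) ∂P :=
          (integral_finsetSum _ fun j _ => hint j).symm
      _ = (n + 1) * min α 1 := by simp [hsum]
  exact mul_left_cancel₀ (by positivity) hsymm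

theorem isValid_conformalFuzzy (hα : 0 ≤ α) {s : Z → ℝ≥0} (hs : Measurable s) :
    (conformalFuzzy α s : FuzzyPredSet n Z).IsValid α :=
  ⟨measurable_conformalFuzzy α hs, fun _ _ hP =>
    (integral_lastDegree_conformalFuzzy hα hs hP).trans_le (min_le_left _ _)⟩

theorem isValid_of_le {D E : FuzzyPredSet n Z} (hE : E.IsValid α)
    (hD : Measurable fun x : (Fin n → Z) × Z => D x.1 x.2) (hDE : ∀ zn z, D zn z ≤ E zn z) :
    D.IsValid α :=
  ⟨hD, fun P _ hP => (integral_mono (integrable_lastDegree hD P)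
    (integrable_lastDegree hE.measurable P) fun _ => hDE _ _).trans (hE.coverage P ‹_› hP)⟩

theorem integral_lastDegree_toFuzzy {C : PredSet n Z}
    (hC : MeasurableSet {x : (Fin n → Z) × Z | x.2 ∈ C x.1}) (P : Measure (Fin (n + 1) → Z))
    [IsProbabilityMeasure P] :
    ∫ z, (lastDegree (toFuzzy C) z : ℝ) ∂P =
      1 - P.real {z | z (Fin.last n) ∈ C fun i => z i.castSucc} := by
  set A := {z : Fin (n + 1) → Z | z (Fin.last n) ∈ C fun i => z i.castSucc}
  have hA : MeasurableSet A := hC.preimage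
    (f := fun z : Fin (n + 1) → Z => (fun i : Fin n => z i.castSucc, z (Fin.last n))) (by fun_prop)
  have hind : (fun z => (lastDegree (toFuzzy C) z : ℝ)) = Aᶜ.indicator 1 := by
    ext z
    by_cases hz : z (Fin.last n) ∈ C fun i => z i.castSucc <;> simp [lastDegree, toFuzzy, A, hz]
  rw [hind, integral_indicator_one hA.compl, probReal_compl_eq_one_sub hA]

theorem isValid_toFuzzy_iff {C : PredSet n Z}
    (hC : MeasurableSet {x : (Fin n → Z) × Z | x.2 ∈ C x.1}) :
    (toFuzzy C).IsValid α ↔ C.IsValid α := by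
  refine ⟨fun h => ⟨hC, fun P _ hP => ?_⟩, fun h => ⟨measurable_toFuzzy hC, fun P _ hP => ?_⟩⟩
  · have := h.coverage P ‹_› hP
    change ∫ z, (lastDegree (toFuzzy C) z : ℝ) ∂P ≤ α at this
    rw [integral_lastDegree_toFuzzy hC] at this
    linarith
  · change ∫ z, (lastDegree (toFuzzy C) z : ℝ) ∂P ≤ α
    rw [integral_lastDegree_toFuzzy hC]
    linarith [h.coverage P ‹_› hP]

theorem isValid_conformalSet (hα : 0 ≤ α) {s : Z → ℝ≥0} (hs : Measurable s) :
    (conformalSet α s : PredSet n Z).IsValid α :=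
  have hC := measurableSet_conformalSet α hs
  (isValid_toFuzzy_iff hC).1 <| isValid_of_le (isValid_conformalFuzzy hα hs)
    (measurable_toFuzzy hC) (toFuzzy_conformalSet_le α s)

theorem sum_perm_lastDegree_le (hα : 0 ≤ α) {s : Z → ℝ≥0} (hs : Measurable s)
    {D : FuzzyPredSet n Z} (hD : D.IsValid α) (z : Fin (n + 1) → Z) :
    ∑ σ : Equiv.Perm (Fin (n + 1)), (lastDegree D (z ∘ σ) : ℝ) ≤
      ∑ σ : Equiv.Perm (Fin (n + 1)), (lastDegree (conformalFuzzy α s) (z ∘ σ) : ℝ) := by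
  have hle_one : ∫ y, (lastDegree D y : ℝ) ∂orbitLaw z ≤ 1 := by
    simpa using integral_mono (integrable_lastDegree hD.measurable _)
      (integrable_const (μ := orbitLaw z) (1 : ℝ)) fun y => (lastDegree D y).2.2
  have hle : ∫ y, (lastDegree D y : ℝ) ∂orbitLaw z ≤
      ∫ y, (lastDegree (conformalFuzzy α s) y : ℝ) ∂orbitLaw z := by
    rw [integral_lastDegree_conformalFuzzy hα hs (isExchangeable_orbitLaw z)]
    exact le_min (hD.coverage _ inferInstance (isExchangeable_orbitLaw z)) hle_one
  rwa [integral_orbitLaw z (measurable_lastDegree hD.measurable).subtype_val,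
    integral_orbitLaw z (measurable_lastDegree (measurable_conformalFuzzy α hs)).subtype_val,
    mul_le_mul_iff_right₀ (by positivity)] at hle

end Validity

section Optimality

variable {Z : Type*} [MeasurableSpace Z] {n : ℕ}

theorem measurable_ofReal_one_sub {D : FuzzyPredSet n Z}
    (hD : Measurable fun x : (Fin n → Z) × Z => D x.1 x.2) :
    Measurable fun x : (Fin n → Z) × Z => ENNReal.ofReal (1 - D x.1 x.2) :=
  (hD.subtype_val.const_sub 1).ennreal_ofReal

theorem expectedSize_withDensity {μ : Measure Z} [SigmaFinite μ] {f : Z → ℝ≥0∞}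
    (hf : Measurable f) [SigmaFinite (μ.withDensity f)] {D : FuzzyPredSet n Z}
    (hD : Measurable fun x : (Fin n → Z) × Z => D x.1 x.2) :
    D.expectedSize μ (Measure.pi fun _ => μ.withDensity f) =
      ∫⁻ z, ENNReal.ofReal (1 - lastDegree D z) * ∏ i : Fin n, f (z i.castSucc)
        ∂(Measure.pi fun _ : Fin (n + 1) => μ) := by
  have hG := measurable_ofReal_one_sub hD
  have hprod : Measurable fun zn : Fin n → Z => ∏ i, f (zn i) := by fun_prop
  rw [FuzzyPredSet.expectedSize, pi_withDensity _ fun _ => hf,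
    lintegral_withDensity_eq_lintegral_mul _ hprod hG.lintegral_prod_right']
  refine Eq.trans (lintegral_congr fun zn => ?_)
    (lintegral_lintegral_pi_eq_lintegral_pi_succ μ (hG.mul (hprod.comp measurable_fst)))
  exact (mul_comm _ _).trans (lintegral_mul_const _ (hG.comp measurable_prodMk_left)).symm

theorem card_perm_mul_expectedSize {μ : Measure Z} [SigmaFinite μ] {f : Z → ℝ≥0∞}
    (hf : Measurable f) [SigmaFinite (μ.withDensity f)] {D : FuzzyPredSet n Z}
    (hD : Measurable fun x : (Fin n → Z) × Z => D x.1 x.2) :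
    Fintype.card (Equiv.Perm (Fin (n + 1))) *
        D.expectedSize μ (Measure.pi fun _ => μ.withDensity f) =
      ∫⁻ z, ∑ σ : Equiv.Perm (Fin (n + 1)), ENNReal.ofReal (1 - lastDegree D (z ∘ σ)) *
        ∏ i ∈ Finset.univ.erase (σ (Fin.last n)), f (z i)
        ∂(Measure.pi fun _ : Fin (n + 1) => μ) := by
  let g (z : Fin (n + 1) → Z) : ℝ≥0∞ :=
    ENNReal.ofReal (1 - lastDegree D z) * ∏ i : Fin n, f (z i.castSucc)
  have hg : Measurable g :=
    ((measurable_lastDegree hD).subtype_val.const_sub 1).ennreal_ofReal.mul (by fun_prop)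
  have hg_perm (z : Fin (n + 1) → Z) (σ : Equiv.Perm (Fin (n + 1))) : g (z ∘ σ) =
      ENNReal.ofReal (1 - lastDegree D (z ∘ σ)) *
        ∏ i ∈ Finset.univ.erase (σ (Fin.last n)), f (z i) := by
    rw [← prod_perm_castSucc fun i => f (z i)]
    rfl
  have hperm (σ : Equiv.Perm (Fin (n + 1))) :=
    measurePreserving_comp_perm (isExchangeable_pi (n := n) μ) σ
  calc Fintype.card (Equiv.Perm (Fin (n + 1))) *
        D.expectedSize μ (Measure.pi fun _ => μ.withDensity f)
      = ∑ σ : Equiv.Perm (Fin (n + 1)), ∫⁻ z, g (z ∘ σ) ∂(Measure.pi fun _ => μ) := by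
        simp only [(hperm _).lintegral_comp hg, Finset.sum_const, Finset.card_univ, nsmul_eq_mul,
          expectedSize_withDensity hf hD, g]
    _ = ∫⁻ z, ∑ σ : Equiv.Perm (Fin (n + 1)), g (z ∘ σ) ∂(Measure.pi fun _ => μ) :=
        (lintegral_finsetSum _ fun σ _ => hg.comp (hperm σ).measurable).symm
    _ = _ := by simp only [hg_perm]

theorem sum_perm_conformalFuzzy_le {α : ℝ} (hα : 0 ≤ α) {s : Z → ℝ≥0} (hs : Measurable s)
    {g : ℝ≥0 → ℝ≥0∞} (hg : Monotone g) {D : FuzzyPredSet n Z} (hD : D.IsValid α)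
    {z : Fin (n + 1) → Z} (hz : ∀ i, g (s (z i)) ≠ ∞) :
    ∑ σ : Equiv.Perm (Fin (n + 1)), ENNReal.ofReal (1 - lastDegree (conformalFuzzy α s) (z ∘ σ)) *
        ∏ i ∈ Finset.univ.erase (σ (Fin.last n)), g (s (z i)) ≤
      ∑ σ : Equiv.Perm (Fin (n + 1)), ENNReal.ofReal (1 - lastDegree D (z ∘ σ)) *
        ∏ i ∈ Finset.univ.erase (σ (Fin.last n)), g (s (z i)) := by
  obtain ⟨t, ht⟩ := exists_isBoundary (by positivity : 0 ≤ α * ((n : ℝ) + 1)) (s ∘ z)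
  have hfin (j : Fin (n + 1)) : ∏ i ∈ Finset.univ.erase j, g (s (z i)) ≠ ∞ :=
    ENNReal.prod_ne_top fun i _ => hz i
  have hanti {j k : Fin (n + 1)} (h : s (z j) ≤ s (z k)) :
      ∏ i ∈ Finset.univ.erase k, g (s (z i)) ≤ ∏ i ∈ Finset.univ.erase j, g (s (z i)) :=
    prod_erase_le_prod_erase (Finset.mem_univ j) (Finset.mem_univ k) (hg h)
  refine sum_ofReal_one_sub_mul_le_of_threshold (fun σ => hfin _) (hfin t) (fun σ hσ => ?_)
    (fun σ hσ => ?_) (sum_perm_lastDegree_le hα hs hD z)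
  · rw [lastDegree_conformalFuzzy_comp_perm]
    exact ht.exclusion_eq_one (not_le.1 fun h => (hanti h).not_gt hσ)
  · rw [lastDegree_conformalFuzzy_comp_perm]
    exact ht.exclusion_eq_zero (not_le.1 fun h => (hanti h).not_gt hσ)

theorem expectedSize_conformalFuzzy_le {α : ℝ} (hα : 0 ≤ α) {s : Z → ℝ≥0} (hs : Measurable s)
    {μ : Measure Z} [SigmaFinite μ] {g : ℝ≥0 → ℝ≥0∞} (hg : Monotone g)
    [SigmaFinite (μ.withDensity (g ∘ s))] {D : FuzzyPredSet n Z} (hD : D.IsValid α) :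
    (conformalFuzzy α s : FuzzyPredSet n Z).expectedSize μ
        (Measure.pi fun _ => μ.withDensity (g ∘ s)) ≤
      D.expectedSize μ (Measure.pi fun _ => μ.withDensity (g ∘ s)) := by
  have hgs : Measurable (g ∘ s) := hg.measurable.comp hs
  have hcard : (Fintype.card (Equiv.Perm (Fin (n + 1))) : ℝ≥0∞) ≠ 0 :=
    mod_cast Fintype.card_ne_zero
  rw [← ENNReal.mul_le_mul_iff_right hcard (ENNReal.natCast_ne_top _),
    card_perm_mul_expectedSize hgs (measurable_conformalFuzzy α hs),
    card_perm_mul_expectedSize hgs hD.measurable]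
  have hfinite : ∀ᵐ z ∂(Measure.pi fun _ : Fin (n + 1) => μ), ∀ i, g (s (z i)) ≠ ∞ :=
    ae_all_iff.2 fun i => (Measure.tendsto_eval_ae_ae (μ := fun _ => μ) (i := i)).eventually
      ((ae_lt_top_of_sigmaFinite_withDensity hgs).mono fun _ => ne_of_lt)
  exact lintegral_mono_ae (hfinite.mono fun z hz => sum_perm_conformalFuzzy_le hα hs hg hD hz)

theorem expectedSize_toFuzzy {C : PredSet n Z}
    (hC : MeasurableSet {x : (Fin n → Z) × Z | x.2 ∈ C x.1}) (μ : Measure Z)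
    (ν : Measure (Fin n → Z)) : (toFuzzy C).expectedSize μ ν = C.expectedSize μ ν := by
  refine lintegral_congr fun zn => ?_
  rw [← lintegral_indicator_one (show MeasurableSet (C zn) from measurable_prodMk_left hC)]
  refine lintegral_congr fun z => ?_
  by_cases hz : z ∈ C zn <;> simp [toFuzzy, hz]

theorem expectedSize_eq_lintegral_lintegral {D : FuzzyPredSet n Z}
    (hD : Measurable fun x : (Fin n → Z) × Z => D x.1 x.2) (μ : Measure Z) [SFinite μ]
    (ν : Measure (Fin n → Z)) [SFinite ν] :
    D.expectedSize μ ν = ∫⁻ z, ∫⁻ zn, ENNReal.ofReal (1 - D zn z) ∂ν ∂μ :=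
  lintegral_lintegral_swap (measurable_ofReal_one_sub hD).aemeasurable

theorem expectedSize_conformalSet_eq {α : ℝ} {s : Z → ℝ≥0} (hs : Measurable s) {k : ℕ}
    (hk : α * (n + 1) = k) (μ : Measure Z) [SFinite μ] {P : Measure Z} [SigmaFinite P]
    (hP : ∀ c : ℝ≥0, P (s ⁻¹' {c}) = 0) :
    (conformalSet α s : PredSet n Z).expectedSize μ (Measure.pi fun _ => P) =
      (conformalFuzzy α s : FuzzyPredSet n Z).expectedSize μ (Measure.pi fun _ => P) := by
  have hC := measurableSet_conformalSet (n := n) α hs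
  rw [← expectedSize_toFuzzy hC, expectedSize_eq_lintegral_lintegral (measurable_toFuzzy hC),
    expectedSize_eq_lintegral_lintegral (measurable_conformalFuzzy α hs)]
  refine lintegral_congr fun z => lintegral_congr_ae ?_
  have hties : ∀ᵐ zn ∂(Measure.pi fun _ : Fin n => P), ∀ i, s (zn i) ≠ s z :=
    ae_all_iff.2 fun i => (Measure.tendsto_eval_ae_ae (μ := fun _ => P) (i := i)).eventually
      (measure_eq_zero_iff_ae_notMem.1 (hP (s z)))
  filter_upwards [hties] with zn hzn
  rw [toFuzzy_conformalSet_of_no_ties hk hzn]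

theorem exists_monotone_withDensity_comp {μ P : Measure Z} [SigmaFinite μ] [SigmaFinite P]
    (hP : P ≪ μ) {s : Z → ℝ≥0} {m : ℝ≥0 → ℝ≥0} (hm : StrictMono m)
    (hs : ∀ᵐ z ∂μ, s z = m (P.rnDeriv μ z).toNNReal) :
    ∃ g : ℝ≥0 → ℝ≥0∞, Monotone g ∧ P = μ.withDensity (g ∘ s) := by
  have hinv : MonotoneOn (fun t => ((Function.invFun m t : ℝ≥0) : ℝ≥0∞)) (Set.range m) := by
    rintro _ ⟨x, rfl⟩ _ ⟨y, rfl⟩ hxy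
    simpa [Function.leftInverse_invFun hm.injective _] using hm.le_iff_le.1 hxy
  obtain ⟨g, hg, hgm⟩ := hinv.exists_monotone_extension (OrderBot.bddBelow _) (OrderTop.bddAbove _)
  refine ⟨g, hg, ?_⟩
  rw [← Measure.withDensity_rnDeriv_eq P μ hP]
  refine withDensity_congr_ae ?_
  filter_upwards [hs, Measure.rnDeriv_lt_top P μ] with z hz hlt
  simp only [Function.comp_apply, hz, ← hgm (Set.mem_range_self _),
    Function.leftInverse_invFun hm.injective _, ENNReal.coe_toNNReal hlt.ne]

end Optimality

end ConformalPrediction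

open Conformal ConformalPrediction in
theorem mainTheorem5_general {Z : Type*} [MeasurableSpace Z] (n : ℕ) {α : ℝ} (hα : 0 ≤ α)
    {s : Z → ℝ≥0} (hs : Measurable s) :
    (conformalFuzzy α s : FuzzyPredSet n Z).IsValid α ∧
    (conformalSet α s : PredSet n Z).IsValid α ∧
    ∀ (μ P : Measure Z) [SigmaFinite μ] [SigmaFinite P],
      (∃ g : ℝ≥0 → ℝ≥0∞, Monotone g ∧ P = μ.withDensity (g ∘ s)) →
        (∀ D : FuzzyPredSet n Z, D.IsValid α →
          (conformalFuzzy α s : FuzzyPredSet n Z).expectedSize μ (Measure.pi fun _ => P) ≤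
            D.expectedSize μ (Measure.pi fun _ => P)) ∧
        (∀ C : PredSet n Z, C.IsValid α →
          (conformalFuzzy α s : FuzzyPredSet n Z).expectedSize μ (Measure.pi fun _ => P) ≤
            C.expectedSize μ (Measure.pi fun _ => P)) ∧
        ((∃ k : ℕ, α * ((n : ℝ) + 1) = k) → (∀ c : ℝ≥0, P (s ⁻¹' {c}) = 0) →
          (∀ D : FuzzyPredSet n Z, D.IsValid α →
            (conformalSet α s : PredSet n Z).expectedSize μ (Measure.pi fun _ => P) ≤
              D.expectedSize μ (Measure.pi fun _ => P)) ∧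
          (∀ C : PredSet n Z, C.IsValid α →
            (conformalSet α s : PredSet n Z).expectedSize μ (Measure.pi fun _ => P) ≤
              C.expectedSize μ (Measure.pi fun _ => P))) := by
  refine ⟨isValid_conformalFuzzy hα hs, isValid_conformalSet hα hs, ?_⟩
  rintro μ P _ hP ⟨g, hg, rfl⟩
  have fuzzy_le (D : FuzzyPredSet n Z) (hD : D.IsValid α) :=
    expectedSize_conformalFuzzy_le hα hs (μ := μ) hg hD
  have fuzzy_le_set (C : PredSet n Z) (hC : C.IsValid α) :=
    (fuzzy_le _ ((isValid_toFuzzy_iff hC.measurableSet).2 hC)).trans_eq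
      (expectedSize_toFuzzy hC.measurableSet μ _)
  refine ⟨fuzzy_le, fuzzy_le_set, fun ⟨k, hk⟩ hatoms => ?_⟩
  rw [expectedSize_conformalSet_eq hs hk μ hatoms]
  exact ⟨fuzzy_le, fuzzy_le_set⟩

theorem mainTheorem5 {Z : Type*} [MeasurableSpace Z] (n : ℕ) (α : ℝ) (hα₀ : 0 < α) (hα₁ : α < 1)
    (s : Z → ℝ≥0) (hs : Measurable s) :
    -- validity at level `α`, for every score
    (Conformal.conformalFuzzy α s : Conformal.FuzzyPredSet n Z).IsValid α ∧
    (Conformal.conformalSet α s : Conformal.PredSet n Z).IsValid α ∧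
    -- optimality, for every `μ` and every true i.i.d. law for which `s` is an increasing function
    -- of the density of an observation
    ∀ (μ : Measure Z) (P : Measure Z), SigmaFinite μ → IsProbabilityMeasure P → P ≪ μ →
      ∀ m : ℝ≥0 → ℝ≥0, StrictMono m → (∀ᵐ z ∂μ, s z = m (P.rnDeriv μ z).toNNReal) →
        (∀ D : Conformal.FuzzyPredSet n Z, D.IsValid α →
          (Conformal.conformalFuzzy α s : Conformal.FuzzyPredSet n Z).expectedSize μ
              (Measure.pi fun _ : Fin n => P) ≤
            D.expectedSize μ (Measure.pi fun _ : Fin n => P)) ∧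
        (∀ C : Conformal.PredSet n Z, C.IsValid α →
          (Conformal.conformalFuzzy α s : Conformal.FuzzyPredSet n Z).expectedSize μ
              (Measure.pi fun _ : Fin n => P) ≤
            C.expectedSize μ (Measure.pi fun _ : Fin n => P)) ∧
        -- when no randomization is needed, the non-randomized conformal set is optimal
        ((∃ k : ℕ, α * ((n : ℝ) + 1) = k) → (∀ c : ℝ≥0, P (s ⁻¹' {c}) = 0) →
          (∀ D : Conformal.FuzzyPredSet n Z, D.IsValid α →
            (Conformal.conformalSet α s : Conformal.PredSet n Z).expectedSize μ
                (Measure.pi fun _ : Fin n => P) ≤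
              D.expectedSize μ (Measure.pi fun _ : Fin n => P)) ∧
          (∀ C : Conformal.PredSet n Z, C.IsValid α →
            (Conformal.conformalSet α s : Conformal.PredSet n Z).expectedSize μ
                (Measure.pi fun _ : Fin n => P) ≤
              C.expectedSize μ (Measure.pi fun _ : Fin n => P))) := by
  obtain ⟨hfuzzy, hset, hopt⟩ := mainTheorem5_general n hα₀.le hs
  exact ⟨hfuzzy, hset, fun μ P _ _ hP m hm hsm =>
    hopt μ P (ConformalPrediction.exists_monotone_withDensity_comp hP hm hsm)⟩
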